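/- Let $\mathbf{Graph}$ be the category of finite simple undirected graphs with injective simplicial maps (injective graph homomorphisms). A categorical persistence function on a category is a lower-bounded $\mathbb{Z}$-valued function $p$ on its morphisms such that, for all $u_1\to u_2\to v_1\to v_2$, one has $p(u_1\to v_1)\le p(u_2\to v_1)$, $p(u_2\to v_2)\le p(u_2\to v_1)$ and $p(u_2\to v_1)-p(u_1\to v_1)\ge p(u_2\to v_2)-p(u_1\to v_2)$. On the poset category $(\mathbb{R},\le)$ we write $p(u,v)$ for its value at $u\le v$. An ip-function generator $p$ in $\mathbf{Graph}$ assigns to each functor $M:(\mathbb{R},\le)\to\mathbf{Graph}$ all of whose morphisms are monic a categorical persistence function $p_M$ on $(\mathbb{R},\le)$, with $p_M=p_{M'}$ whenever $M$ and $M'$ are naturally isomorphic. A weighted graph $(G,f)$ is a finite simple graph $G=(V,E)$ with a function $f:E\to\mathbb{R}$; $p_{(G,f)}$ denotes $p_M$ for the filtration $M:u\mapsto G_u$, where $G_u$ is the subgraph of $G$ induced by the edge set $f^{-1}((-\infty,u])$ (these edges and their end points). The generator $p$ is balanced if, for all weighted graphs $(G,f)$, $(G',f')$, every graph isomorphism $\psi:G\to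 G'$ and every real $h>0$ with $\sup_{e\in E}|f(e)-f'(\psi(e))|\le h$, one has $p_{(G,f)}(u-h,v+h)\le p_{(G',f')}(u,v)$ for all real $u<v$. The persistence diagram $D(f)$ of $q=p_{(G,f)}$ is the multiset of points of $\{(u,v)\in\mathbb{R}\times(\mathbb{R}\cup\{+\infty\}) : u\le v\}$ in which every point $(u,u)$ has (countably) infinite multiplicity, a point $(u,v)$ with $u<v<+\infty$ has multiplicity $$\min_{\varepsilon>0,\ u+\varepsilon<v-\varepsilon} \big(q(u+\varepsilon,v-\varepsilon)-q(u-\varepsilon,v-\varepsilon)-q(u+\varepsilon,v+\varepsilon)+q(u-\varepsilon,v+\varepsilon)\big),$$ and a point $(u,+\infty)$ has multiplicity $\min_{\varepsilon>0,\ v>u+\varepsilon}\big(q(u+\varepsilon,v)-q(u-\varepsilon,v)\big)$. The bottleneck distance of two persistence diagrams is $$d(D,D')=\inf_{\gamma}\sup_{x\in D}\|x-\gamma(x)\|_\infty\in[0,+\infty],$$ where $\gamma$ runs over all bijections $D\to D'$ of multisets, with $|\infty-\infty|=0$ and $|\infty-b|=+\infty$ for real $b$. The natural pseudodistance of $(G,f)$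 and $(G',f')$ is $$\delta\big((G,f),(G',f')\big)=\inf_{\phi}\sup_{e\in E}|f(e)-f'(\phi(e))|,$$ where $\phi$ runs over all graph isomorphisms $G\to G'$; it is $+\infty$ if there is none. **Theorem (Stability).** Let $p$ be a balanced ip-function generator in $\mathbf{Graph}$, and let $(G,f)$, $(G',f')$ be two weighted graphs. Then $$d\big(D(f),D(f')\big)\le\delta\big((G,f),(G',f')\big).$$ -/

import Mathlib

open CategoryTheory
open scoped ENNReal

universe w

/-! ### The category of finite simple graphs and injective simplicial maps -/

/-- A finite simple undirected graph (possibly empty). -/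
structure FinGraph : Type (w + 1) where
  /-- The vertices. -/
  V : Type w
  [finite : Finite V]
  /-- The adjacency relation. -/
  graph : SimpleGraph V

/-- Morphisms are the injective simplicial maps. As such a map cannot collapse an edge to a
vertex, these are the injective graph homomorphisms, which Mathlib calls `SimpleGraph.Copy`. -/
instance FinGraph.instCategory : Category FinGraph.{w} where
  Hom G H := SimpleGraph.Copy G.graph H.graph
  id G := SimpleGraph.Copy.id G.graph
  comp f g := SimpleGraph.Copy.comp g f

theorem FinGraph.mono_hom {G H : FinGraph.{w}} (f : G ⟶ H) : Mono f where
  right_cancellation {Z} g h e := by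
    have key : ∀ x : Z.V, (show SimpleGraph.Copy Z.graph G.graph from g) x =
        (show SimpleGraph.Copy Z.graph G.graph from h) x := fun x =>
      (show SimpleGraph.Copy G.graph H.graph from f).injective
        (DFunLike.congr_fun
          (show SimpleGraph.Copy.comp (show SimpleGraph.Copy G.graph H.graph from f) g =
            SimpleGraph.Copy.comp (show SimpleGraph.Copy G.graph H.graph from f) h from e) x)
    exact DFunLike.ext (F := SimpleGraph.Copy Z.graph G.graph) g h key

/-! ### Categorical persistence functions and ip-function generators -/

/-- A categorical persistence function on a category: a lower bounded integer-valued function on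
morphisms such that, for every chain `u₁ ⟶ u₂ ⟶ v₁ ⟶ v₂`, the usual inequalities hold. -/
structure CategoricalPersistenceFunction (C : Type*) [Category C] where
  /-- The value on a morphism. -/
  val : ∀ {u v : C}, (u ⟶ v) → ℤ
  lowerBounded : ∃ m : ℤ, ∀ {u v : C} (f : u ⟶ v), m ≤ val f
  le_left : ∀ {u₁ u₂ v₁ : C} (f : u₁ ⟶ u₂) (g : u₂ ⟶ v₁), val (f ≫ g) ≤ val g
  le_right : ∀ {u₂ v₁ v₂ : C} (g : u₂ ⟶ v₁) (k : v₁ ⟶ v₂), val (g ≫ k) ≤ val g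
  sub_ge_sub : ∀ {u₁ u₂ v₁ v₂ : C} (f : u₁ ⟶ u₂) (g : u₂ ⟶ v₁) (k : v₁ ⟶ v₂),
    val g - val (f ≫ g) ≥ val (g ≫ k) - val (f ≫ g ≫ k)

/-- An `(ℝ, ≤)`-indexed diagram is monic if it sends all morphisms to monomorphisms. -/
def IsMonicDiagram {C : Type*} [Category C] (M : ℝ ⥤ C) : Prop :=
  ∀ {u v : ℝ} (f : u ⟶ v), Mono (M.map f)

/-- An ip-function generator in `C`: it assigns to each monic `(ℝ, ≤)`-indexed diagram a
categorical persistence function on `(ℝ, ≤)`, the same one to naturally isomorphic diagrams. -/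
structure IpFunctionGenerator (C : Type*) [Category C] where
  /-- The persistence function of a monic diagram. -/
  toFun : ∀ M : ℝ ⥤ C, IsMonicDiagram M → CategoricalPersistenceFunction ℝ
  iso_invariant : ∀ (M M' : ℝ ⥤ C) (hM : IsMonicDiagram M) (hM' : IsMonicDiagram M'),
    Nonempty (M ≅ M') → toFun M hM = toFun M' hM'

open Classical in
/-- The value `p(u, v)` at the morphism `u ⟶ v` of `(ℝ, ≤)`, that is, at a pair `u ≤ v`.
(It is only ever used for `u ≤ v`; the value `0` for `v < u` is a convention.) -/
noncomputable def CategoricalPersistenceFunction.at (p : CategoricalPersistenceFunction ℝ)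
    (u v : ℝ) : ℤ :=
  if h : u ≤ v then p.val (homOfLE h) else 0

/-! ### Persistence diagrams and the bottleneck distance -/

/-- A persistence diagram: a multiset of points `(u, v)` of `ℝ × (ℝ ∪ {+∞})` with `u ≤ v`, given
by the multiplicities of its points, in which every diagonal point has infinite multiplicity. -/
structure PersistenceDiagram where
  /-- The multiplicity of a point. -/
  mult : ℝ × WithTop ℝ → ℕ∞
  above : ∀ (u : ℝ) (v : WithTop ℝ), mult (u, v) ≠ 0 → (u : WithTop ℝ) ≤ v
  diagonal : ∀ u : ℝ, mult (u, (u : WithTop ℝ)) = ⊤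

/-- The elements of a persistence diagram counted with multiplicity: a point together with the
index of one of its copies (a point of infinite multiplicity has one copy for each `i : ℕ`). -/
def PersistenceDiagram.Element (D : PersistenceDiagram) : Type :=
  Σ x : ℝ × WithTop ℝ, {i : ℕ // (i : ℕ∞) < D.mult x}

/-- The distance on `ℝ ∪ {+∞}`, with `|∞ - ∞| = 0` and `|∞ - b| = ∞` for real `b`. -/
noncomputable def ordinateDist : WithTop ℝ → WithTop ℝ → ℝ≥0∞
  | (a : ℝ), (b : ℝ) => ENNReal.ofReal |a - b|
  | ⊤, ⊤ => 0
  | _, _ => ⊤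

/-- The distance `‖x - y‖_∞` between points of `ℝ × (ℝ ∪ {+∞})`. -/
noncomputable def pointDist (x y : ℝ × WithTop ℝ) : ℝ≥0∞ :=
  max (ENNReal.ofReal |x.1 - y.1|) (ordinateDist x.2 y.2)

/-- The bottleneck distance: the infimum over all bijections `γ : D → D'` of the supremum of the
displacements `‖x - γ(x)‖_∞`. -/
noncomputable def bottleneckDist (D D' : PersistenceDiagram) : ℝ≥0∞ :=
  ⨅ γ : D.Element ≃ D'.Element, ⨆ x : D.Element, pointDist x.1 (γ x).1

namespace CategoricalPersistenceFunction

/-- The multiplicity of a point `(u, v)` with `u < v < +∞`: the minimum over the `ε > 0` with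
`u + ε < v - ε` of the (nonnegative) number
`p(u+ε, v-ε) - p(u-ε, v-ε) - p(u+ε, v+ε) + p(u-ε, v+ε)`. It is zero if `v ≤ u`. -/
noncomputable def properMult (p : CategoricalPersistenceFunction ℝ) (u v : ℝ) : ℕ :=
  sInf {n : ℕ | ∃ ε : ℝ, 0 < ε ∧ u + ε < v - ε ∧
    (n : ℤ) = p.at (u + ε) (v - ε) - p.at (u - ε) (v - ε)
      - p.at (u + ε) (v + ε) + p.at (u - ε) (v + ε)}

/-- The multiplicity of a point at infinity `(u, +∞)`: the minimum over the `ε > 0` and the real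
`v > u + ε` of the (nonnegative) number `p(u+ε, v) - p(u-ε, v)`. -/
noncomputable def infiniteMult (p : CategoricalPersistenceFunction ℝ) (u : ℝ) : ℕ :=
  sInf {n : ℕ | ∃ ε v : ℝ, 0 < ε ∧ u + ε < v ∧ (n : ℤ) = p.at (u + ε) v - p.at (u - ε) v}

theorem lt_of_properMult_ne_zero (p : CategoricalPersistenceFunction ℝ) {u v : ℝ}
    (h : p.properMult u v ≠ 0) : u < v := by
  by_contra hv
  apply h
  have : {n : ℕ | ∃ ε : ℝ, 0 < ε ∧ u + ε < v - ε ∧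
      (n : ℤ) = p.at (u + ε) (v - ε) - p.at (u - ε) (v - ε)
        - p.at (u + ε) (v + ε) + p.at (u - ε) (v + ε)} = ∅ := by
    ext n
    simp only [Set.mem_ofPred_eq, Set.mem_empty_iff_false, iff_false]
    rintro ⟨ε, h1, h2, -⟩
    linarith
  rw [properMult, this, Nat.sInf_empty]

open Classical in
/-- The multiplicities of the persistence diagram of `p`. -/
noncomputable def diagramMult (p : CategoricalPersistenceFunction ℝ) :
    ℝ × WithTop ℝ → ℕ∞
  | (u, ⊤) => (p.infiniteMult u : ℕ∞)
  | (u, (v : ℝ)) => if u = v then ⊤ else (p.properMult u v : ℕ∞)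

/-- The persistence diagram of a categorical persistence function on `(ℝ, ≤)`. -/
noncomputable def diagram (p : CategoricalPersistenceFunction ℝ) : PersistenceDiagram where
  mult := p.diagramMult
  above u v h := by
    induction v using WithTop.recTopCoe with
    | top => exact le_top
    | coe v =>
      rw [WithTop.coe_le_coe]
      by_cases huv : u = v
      · exact huv.le
      · have h' : (p.properMult u v : ℕ∞) ≠ 0 := by
          have : p.diagramMult (u, (v : WithTop ℝ)) = (p.properMult u v : ℕ∞) := if_neg huv
          rwa [this] at h
        exact (p.lt_of_properMult_ne_zero (by exact_mod_cast h')).le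
  diagonal u := if_pos rfl

end CategoricalPersistenceFunction

/-! ### Weighted graphs and their filtrations -/

/-- A weighted graph `(G, f)`: a finite simple graph with a real weight on each edge. -/
structure WeightedGraph : Type (w + 1) extends FinGraph.{w} where
  /-- The weight `f`. -/
  weight : graph.edgeSet → ℝ

namespace WeightedGraph

/-- The subgraph `G_u` induced by the edges of weight at most `u`: its edges are these edges and
its vertices are their end points. -/
def sublevel (W : WeightedGraph.{w}) (u : ℝ) : W.graph.Subgraph where
  verts := {x | ∃ (y : W.V) (h : W.graph.Adj x y), W.weight ⟨s(x, y), h⟩ ≤ u}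
  Adj x y := ∃ h : W.graph.Adj x y, W.weight ⟨s(x, y), h⟩ ≤ u
  adj_sub h := h.1
  edge_vert {x y} h := ⟨y, h⟩
  symm := ⟨fun x y ⟨h, hu⟩ => ⟨h.symm, by
    have e : (⟨s(y, x), h.symm⟩ : W.graph.edgeSet) = ⟨s(x, y), h⟩ := Subtype.ext Sym2.eq_swap
    rwa [e]⟩⟩

theorem sublevel_mono (W : WeightedGraph.{w}) {u v : ℝ} (h : u ≤ v) :
    W.sublevel u ≤ W.sublevel v :=
  ⟨fun _ ⟨y, hy, hu⟩ => ⟨y, hy, hu.trans h⟩, fun _ _ ⟨hy, hu⟩ => ⟨hy, hu.trans h⟩⟩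

/-- The filtration `u ↦ G_u` with the inclusions, as an `(ℝ, ≤)`-indexed diagram of graphs. -/
def filtration (W : WeightedGraph.{w}) : ℝ ⥤ FinGraph.{w} where
  obj u :=
    { V := (W.sublevel u).verts
      finite := haveI := W.finite; Subtype.finite
      graph := (W.sublevel u).coe }
  map f := ⟨SimpleGraph.Subgraph.inclusion (W.sublevel_mono (leOfHom f)),
    SimpleGraph.Subgraph.inclusion.injective (W.sublevel_mono (leOfHom f))⟩

theorem filtration_isMonic (W : WeightedGraph.{w}) : IsMonicDiagram W.filtration :=
  fun f => FinGraph.mono_hom (W.filtration.map f)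

/-- The supremum over the edges `e` of `G` of `|f(e) - f'(ψ(e))|`, for a graph isomorphism `ψ`
from `G` to `G'`. -/
noncomputable def weightDiff (W W' : WeightedGraph.{w}) (ψ : W.graph ≃g W'.graph) : ℝ≥0∞ :=
  ⨆ e : W.graph.edgeSet, ENNReal.ofReal |W.weight e - W'.weight (ψ.mapEdgeSet e)|

/-- The natural pseudodistance: the infimum of `weightDiff` over all graph isomorphisms. The
infimum over the empty family in `[0, +∞]` is `+∞`, as wanted for non-isomorphic graphs. -/
noncomputable def naturalPseudodist (W W' : WeightedGraph.{w}) : ℝ≥0∞ :=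
  ⨅ ψ : W.graph ≃g W'.graph, weightDiff W W' ψ

end WeightedGraph

namespace IpFunctionGenerator

/-- The ip-function `p_{(G, f)}` of a weighted graph: that of the filtration it produces. -/
def ofWeighted (p : IpFunctionGenerator FinGraph.{w}) (W : WeightedGraph.{w}) :
    CategoricalPersistenceFunction ℝ :=
  p.toFun W.filtration W.filtration_isMonic

/-- An ip-function generator in graphs is balanced if `p_{(G,f)}(u-h, v+h) ≤ p_{(G',f')}(u, v)`
for all `u < v` whenever `h > 0` and there is a graph isomorphism `ψ : G → G'` with
`sup_e |f(e) - f'(ψ(e))| ≤ h`. -/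
def Balanced (p : IpFunctionGenerator FinGraph.{w}) : Prop :=
  ∀ (W W' : WeightedGraph.{w}) (ψ : W.graph ≃g W'.graph) (h : ℝ), 0 < h →
    WeightedGraph.weightDiff W W' ψ ≤ ENNReal.ofReal h →
    ∀ u v : ℝ, u < v → (p.ofWeighted W).at (u - h) (v + h) ≤ (p.ofWeighted W').at u v

end IpFunctionGenerator

/-!
The diagram of a persistence function `q` records its jumps: after `q` is restricted to a quadrant
`u ≤ w ≤ v`, the multiplicity of a point is the limit of alternating sums over boxes shrinking to
it, and a box has as many points as its alternating sum says. By iso-invariance we may pull `f'`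
back to `G`; interpolating linearly between the two weights of `G` then gives a path of persistence
functions, and balancedness bounds how fast it moves. A box which is a little larger than the
interleaving parameter keeps its alternating sum, so that every point of the diagram can be
followed with bounded speed for a short time. By a compactness argument along the path, this holds
up to time `1` for all finite sets of points, as long as they stay away from the diagonal. Hall's
marriage theorem makes it an injection of diagrams, the points close to the diagonal being sent
there, and the Schröder–Bernstein theorem turns the injections for the path and for the reversed
path into a bijection.
-/

open Set Filter Topology Function

/-! ### Jumps of monotone integer-valued functions -/

theorem Icc_induction_of_frequently_left {α : Type*} [ConditionallyCompleteLinearOrder α]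
    [TopologicalSpace α] [OrderTopology α] {P : α → Prop} {a b : α} (hab : a ≤ b) (ha : P a)
    (hleft : ∀ t ∈ Ioc a b, (∃ᶠ s in 𝓝[<] t, P s) → P t)
    (hright : ∀ t ∈ Ico a b, P t → ∃ s ∈ Ioc t b, P s) : P b := by
  have haS : a ∈ {t ∈ Icc a b | P t} := ⟨left_mem_Icc.2 hab, ha⟩
  obtain ⟨c, hc⟩ : ∃ c, IsLUB {t ∈ Icc a b | P t} c :=
    ⟨_, isLUB_csSup ⟨a, haS⟩ ⟨b, fun t ht => ht.1.2⟩⟩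
  have hac : a ≤ c := hc.1 haS
  have hcb : c ≤ b := hc.2 fun t ht => ht.1.2
  have hPc : P c := by
    by_contra hPc
    have hlt : a < c := hac.lt_of_ne fun h => hPc (h ▸ ha)
    have hfreq := hc.frequently_mem ⟨a, haS⟩
    rw [← Iio_union_right, nhdsWithin_union, frequently_sup, nhdsWithin_singleton,
      frequently_pure] at hfreq
    exact hPc <| hleft c ⟨hlt, hcb⟩ <|
      (hfreq.resolve_right fun h => hPc h.2).mono fun s hs => hs.2
  rcases hcb.eq_or_lt with rfl | hlt
  · exact hPc
  · obtain ⟨s, hs, hPs⟩ := hright c ⟨hac, hlt⟩ hPc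
    exact absurd (hc.1 ⟨⟨hac.trans hs.1.le, hs.2⟩, hPs⟩) hs.1.not_ge

/-- The jump of an integer-valued function at `a`, the difference of its one-sided limits there;
for a monotone function it plays the role of the mass of the point `a`. -/
noncomputable def jumpAt (g : ℝ → ℤ) (a : ℝ) : ℤ := rightLim g a - leftLim g a

/-- `g` has reached its one-sided limits at `a` throughout the punctured interval of radius `r`
around `a`, endpoints included. -/
structure ConstNear (g : ℝ → ℤ) (a r : ℝ) : Prop where
  right : ∀ x ∈ Ioc a (a + r), g x = rightLim g a
  left : ∀ x ∈ Ico (a - r) a, g x = leftLim g a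

section Jump

variable {g : ℝ → ℤ} {a r : ℝ}

theorem ConstNear.sub_eq_jumpAt (hg : ConstNear g a r) (hr : 0 < r) :
    g (a + r) - g (a - r) = jumpAt g a := by
  rw [hg.right _ ⟨by linarith, le_rfl⟩, hg.left _ ⟨le_rfl, by linarith⟩, jumpAt]

theorem eventually_constNear (hr : Tendsto g (𝓝[>] a) (𝓝 (rightLim g a)))
    (hl : Tendsto g (𝓝[<] a) (𝓝 (leftLim g a))) : ∀ᶠ r in 𝓝[>] 0, ConstNear g a r := by
  rw [nhds_discrete, tendsto_pure] at hr hl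
  obtain ⟨c, hc, hgc⟩ := mem_nhdsGT_iff_exists_Ioc_subset.1 hr
  obtain ⟨d, hd, hgd⟩ := mem_nhdsLT_iff_exists_Ico_subset.1 hl
  filter_upwards [Ioc_mem_nhdsGT (sub_pos.2 hc), Ioc_mem_nhdsGT (sub_pos.2 hd)] with r hrc hrd
  exact ⟨fun x hx => hgc ⟨hx.1, by linarith [hx.2, hrc.2]⟩,
    fun x hx => hgd ⟨by linarith [hx.1, hrd.2], hx.2⟩⟩

theorem jumpAt_nonneg (hg : Monotone g) (a : ℝ) : 0 ≤ jumpAt g a :=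
  sub_nonneg.2 (hg.leftLim_le_rightLim le_rfl)

theorem eventually_sub_eq_jumpAt (hg : Monotone g) (a : ℝ) :
    ∀ᶠ r in 𝓝[>] 0, g (a + r) - g (a - r) = jumpAt g a := by
  filter_upwards [eventually_constNear (hg.tendsto_rightLim a) (hg.tendsto_leftLim a),
    self_mem_nhdsWithin] with r h hr using h.sub_eq_jumpAt hr

theorem sum_jumpAt_le_leftLim_sub_rightLim (hg : Monotone g) (T : Finset ℝ) {α β : ℝ} (hαβ : α < β)
    (hT : ↑T ⊆ Ioo α β) : ∑ c ∈ T, jumpAt g c ≤ leftLim g β - rightLim g α := by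
  induction T using Finset.induction_on_max generalizing β with
  | empty => simpa using hg.rightLim_le_leftLim hαβ
  | insert c T hlt ih =>
    rw [Finset.coe_insert, insert_subset_iff] at hT
    have hc := ih hT.1.1 fun d hd => ⟨(hT.2 hd).1, hlt d hd⟩
    have hβ := hg.rightLim_le_leftLim hT.1.2
    rw [Finset.sum_insert fun hcT => (hlt c hcT).false, jumpAt]
    linarith

theorem sum_jumpAt_le (hg : Monotone g) (T : Finset ℝ) {α β : ℝ} (hαβ : α ≤ β) (hT : ↑T ⊆ Ioo α β) :
    ∑ c ∈ T, jumpAt g c ≤ g β - g α := by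
  rcases hαβ.eq_or_lt with rfl | hlt
  · rw [Ioo_self, subset_empty_iff, Finset.coe_eq_empty] at hT
    simp [hT]
  · exact (sum_jumpAt_le_leftLim_sub_rightLim hg T hlt hT).trans
      (sub_le_sub (hg.leftLim_le le_rfl) (hg.le_rightLim le_rfl))

theorem exists_sum_jumpAt_eq (hg : Monotone g) {α β : ℝ} (hαβ : α ≤ β) :
    ∃ T : Finset ℝ, ↑T ⊆ Icc α β ∧ ∑ c ∈ T, jumpAt g c = rightLim g β - leftLim g α := by
  refine Icc_induction_of_frequently_left
    (P := fun x => ∃ T : Finset ℝ, ↑T ⊆ Icc α x ∧ ∑ c ∈ T, jumpAt g c = rightLim g x - leftLim g α)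
    hαβ ⟨{α}, by simp, by simp [jumpAt]⟩ (fun t ht hfreq => ?_) (fun t ht hPt => ?_)
  · have hev : ∀ᶠ s in 𝓝[<] t, rightLim g s = leftLim g t := by
      have := hg.rightLim.tendsto_leftLim t
      rwa [leftLim_rightLim (hg.tendsto_leftLim t), nhds_discrete, tendsto_pure] at this
    obtain ⟨s, ⟨T, hT, hsum⟩, hs, hst⟩ :=
      (hfreq.and_eventually (hev.and self_mem_nhdsWithin)).exists
    have htT : t ∉ T := fun h => ((hT h).2.trans_lt hst).false
    refine ⟨insert t T, ?_, ?_⟩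
    · rw [Finset.coe_insert, insert_subset_iff]
      exact ⟨right_mem_Icc.2 ht.1.le, hT.trans (Icc_subset_Icc_right (mem_Iio.1 hst).le)⟩
    · rw [Finset.sum_insert htT, hsum, jumpAt, hs]
      ring
  · obtain ⟨T, hT, hsum⟩ := hPt
    have hev : ∀ᶠ s in 𝓝[>] t, rightLim g s = rightLim g t := by
      have := hg.rightLim.tendsto_rightLim t
      rwa [rightLim_rightLim (hg.tendsto_rightLim t), nhds_discrete, tendsto_pure] at this
    obtain ⟨s, hs, hts⟩ := (hev.and (Ioc_mem_nhdsGT ht.2)).exists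
    exact ⟨s, hts, T, hT.trans (Icc_subset_Icc_right hts.1.le), by rw [hsum, hs]⟩

theorem exists_sub_le_sum_jumpAt (hg : Monotone g) {α β : ℝ} (hαβ : α ≤ β) :
    ∃ T : Finset ℝ, ↑T ⊆ Icc α β ∧ g β - g α ≤ ∑ c ∈ T, jumpAt g c := by
  obtain ⟨T, hT, hsum⟩ := exists_sum_jumpAt_eq hg hαβ
  exact ⟨T, hT, hsum ▸ sub_le_sub (hg.le_rightLim le_rfl) (hg.leftLim_le le_rfl)⟩

end Jump

theorem jumpAt_sub {g g' : ℝ → ℤ} (hg : Monotone g) (hg' : Monotone g') (a : ℝ) :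
    jumpAt (fun x => g x - g' x) a = jumpAt g a - jumpAt g' a := by
  rw [jumpAt, rightLim_eq_of_tendsto ((hg.tendsto_rightLim a).sub (hg'.tendsto_rightLim a)),
    leftLim_eq_of_tendsto ((hg.tendsto_leftLim a).sub (hg'.tendsto_leftLim a)),
    jumpAt, jumpAt]
  ring

/-! ### Rank-like functions of two real variables -/

/-- A function on the plane with the properties of a persistence function, extended beyond the
half-plane `u ≤ v`. -/
structure RankLike (F : ℝ → ℝ → ℤ) : Prop where
  mono_left : ∀ v, Monotone fun u => F u v
  anti_right : ∀ u, Antitone (F u)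
  sub_anti : ∀ {u u' v v' : ℝ}, u ≤ u' → v ≤ v' → F u' v' - F u v' ≤ F u' v - F u v

/-- The alternating sum of `F` over the corners of the box `[u₁, u₂] × [v₁, v₂]`, the mass which
`F` gives to the box. -/
def boxSum (F : ℝ → ℝ → ℤ) (u₁ u₂ v₁ v₂ : ℝ) : ℤ := F u₂ v₁ - F u₁ v₁ - F u₂ v₂ + F u₁ v₂

/-- The mass which `F` gives to the point `(a, b)`, as an iterated jump. -/
noncomputable def cornerMult (F : ℝ → ℝ → ℤ) (a b : ℝ) : ℤ :=
  jumpAt (fun v => -jumpAt (fun u => F u v) a) b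

/-- `F` is constant on each of the four open quadrants of the square of radius `r` centred
at `(a, b)`, the outer sides of the square included. -/
structure IsQuadrantConst (F : ℝ → ℝ → ℤ) (a b r : ℝ) : Prop where
  right_below : ∀ u ∈ Ioc a (a + r), ∀ v ∈ Ico (b - r) b, F u v = F (a + r) (b - r)
  left_below : ∀ u ∈ Ico (a - r) a, ∀ v ∈ Ico (b - r) b, F u v = F (a - r) (b - r)
  right_above : ∀ u ∈ Ioc a (a + r), ∀ v ∈ Ioc b (b + r), F u v = F (a + r) (b + r)
  left_above : ∀ u ∈ Ico (a - r) a, ∀ v ∈ Ioc b (b + r), F u v = F (a - r) (b + r)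

namespace RankLike

variable {F : ℝ → ℝ → ℤ}

theorem boxSum_mono (hF : RankLike F) {u₁ u₂ v₁ v₂ u₁' u₂' v₁' v₂' : ℝ} (hu₁ : u₁' ≤ u₁)
    (hu : u₁ ≤ u₂) (hu₂ : u₂ ≤ u₂') (hv₁ : v₁' ≤ v₁) (hv : v₁ ≤ v₂) (hv₂ : v₂ ≤ v₂') :
    boxSum F u₁ u₂ v₁ v₂ ≤ boxSum F u₁' u₂' v₁' v₂' := by
  have left := hF.sub_anti hu₁ (hv₁.trans (hv.trans hv₂))
  have right := hF.sub_anti hu₂ (hv₁.trans (hv.trans hv₂))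
  have below := hF.sub_anti hu hv₁
  have above := hF.sub_anti hu hv₂
  unfold boxSum
  linarith

theorem eq_of_eq (hF : RankLike F) {u u' v v' : ℝ} (hu : u ≤ u') (hv : v ≤ v')
    (h : F u v = F u' v) : F u v' = F u' v' := by
  have hle := hF.mono_left v' hu
  have hge := hF.sub_anti hu hv
  dsimp only at hle
  linarith

theorem eventually_forall_constNear (hF : RankLike F) (a v₀ : ℝ) :
    ∀ᶠ r in 𝓝[>] 0, ∀ v, v₀ ≤ v → ConstNear (fun u => F u v) a r := by
  have hlim (v : ℝ) := eventually_constNear ((hF.mono_left v).tendsto_rightLim a)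
    ((hF.mono_left v).tendsto_leftLim a)
  filter_upwards [hlim v₀] with r hr v hv
  constructor <;> intro x hx
  · obtain ⟨s, hs, hsx⟩ := ((hlim v).and (Ioc_mem_nhdsGT (sub_pos.2 hx.1))).exists
    have hsx' : a + s ≤ x := by linarith [hsx.2]
    have has : a + s ∈ Ioc a (a + s) := ⟨by linarith [hsx.1], le_rfl⟩
    rw [← hs.right _ has]
    exact (hF.eq_of_eq hsx' hv ((hr.right _ ⟨has.1, hsx'.trans hx.2⟩).trans
      (hr.right x hx).symm)).symm
  · obtain ⟨s, hs, hsx⟩ := ((hlim v).and (Ioc_mem_nhdsGT (sub_pos.2 hx.2))).exists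
    have hsx' : x ≤ a - s := by linarith [hsx.2]
    have has : a - s ∈ Ico (a - s) a := ⟨le_rfl, by linarith [hsx.1]⟩
    rw [← hs.left _ has]
    exact hF.eq_of_eq hsx' hv ((hr.left x hx).trans (hr.left _ ⟨hx.1.trans hsx', has.2⟩).symm)

theorem eventually_isQuadrantConst (hF : RankLike F) (a b : ℝ) :
    ∀ᶠ r in 𝓝[>] 0, IsQuadrantConst F a b r := by
  obtain ⟨ρ, hρ, hρ0⟩ :=
    ((hF.eventually_forall_constNear a (b - 1)).and self_mem_nhdsWithin).exists
  have hright {x v : ℝ} (hx : x ∈ Ioc a (a + ρ)) (hv : b - 1 ≤ v) : F x v = F (a + ρ) v :=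
    ((hρ v hv).right x hx).trans ((hρ v hv).right _ ⟨lt_add_of_pos_right a hρ0, le_rfl⟩).symm
  have hleft {x v : ℝ} (hx : x ∈ Ico (a - ρ) a) (hv : b - 1 ≤ v) : F x v = F (a - ρ) v :=
    ((hρ v hv).left x hx).trans ((hρ v hv).left _ ⟨le_rfl, sub_lt_self a hρ0⟩).symm
  have hlim (u : ℝ) := eventually_constNear ((hF.anti_right u).tendsto_rightLim b)
    ((hF.anti_right u).tendsto_leftLim b)
  filter_upwards [hlim (a + ρ), hlim (a - ρ), Ioc_mem_nhdsGT (mem_Ioi.1 hρ0),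
    Ioc_mem_nhdsGT one_pos] with r hrR hrL hrρ hr1
  have hxr : ∀ x ∈ Ioc a (a + r), x ∈ Ioc a (a + ρ) := Ioc_subset_Ioc_right (by linarith [hrρ.2])
  have hxl : ∀ x ∈ Ico (a - r) a, x ∈ Ico (a - ρ) a := Ico_subset_Ico_left (by linarith [hrρ.2])
  have har : a + r ∈ Ioc a (a + r) := ⟨by linarith [hr1.1], le_rfl⟩
  have hal : a - r ∈ Ico (a - r) a := ⟨le_rfl, by linarith [hr1.1]⟩
  have hba : b + r ∈ Ioc b (b + r) := ⟨by linarith [hr1.1], le_rfl⟩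
  have hbb : b - r ∈ Ico (b - r) b := ⟨le_rfl, by linarith [hr1.1]⟩
  have hva {v : ℝ} (hv : v ∈ Ioc b (b + r)) : b - 1 ≤ v := by linarith [hv.1]
  have hvb {v : ℝ} (hv : v ∈ Ico (b - r) b) : b - 1 ≤ v := by linarith [hv.1, hr1.2]
  constructor <;> intro u hu v hv
  · rw [hright (hxr u hu) (hvb hv), hright (hxr _ har) (hvb hbb), hrR.left v hv, hrR.left _ hbb]
  · rw [hleft (hxl u hu) (hvb hv), hleft (hxl _ hal) (hvb hbb), hrL.left v hv, hrL.left _ hbb]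
  · rw [hright (hxr u hu) (hva hv), hright (hxr _ har) (hva hba), hrR.right v hv,
      hrR.right _ hba]
  · rw [hleft (hxl u hu) (hva hv), hleft (hxl _ hal) (hva hba), hrL.right v hv,
      hrL.right _ hba]

theorem monotone_neg_jumpAt (hF : RankLike F) (a : ℝ) :
    Monotone fun v => -jumpAt (fun u => F u v) a := by
  intro v v' hv
  obtain ⟨r, ⟨h, h'⟩, hr⟩ := ((eventually_sub_eq_jumpAt (hF.mono_left v) a).and
    (eventually_sub_eq_jumpAt (hF.mono_left v') a)).and self_mem_nhdsWithin |>.exists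
  rw [neg_le_neg_iff, ← h, ← h']
  exact hF.sub_anti (by linarith [hr]) hv

theorem cornerMult_nonneg (hF : RankLike F) (a b : ℝ) : 0 ≤ cornerMult F a b :=
  jumpAt_nonneg (hF.monotone_neg_jumpAt a) b

theorem eventually_boxSum_eq_cornerMult (hF : RankLike F) (a b : ℝ) :
    ∀ᶠ r in 𝓝[>] 0, boxSum F (a - r) (a + r) (b - r) (b + r) = cornerMult F a b := by
  filter_upwards [hF.eventually_forall_constNear a (b - 1),
    eventually_sub_eq_jumpAt (hF.monotone_neg_jumpAt a) b, Ioc_mem_nhdsGT one_pos]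
    with r hr hjump hr1
  have hbelow := (hr (b - r) (by linarith [hr1.2])).sub_eq_jumpAt hr1.1
  have habove := (hr (b + r) (by linarith [hr1.1])).sub_eq_jumpAt hr1.1
  rw [cornerMult, ← hjump, ← hbelow, ← habove, boxSum]
  ring

theorem monotone_sub (hF : RankLike F) {v₁ v₂ : ℝ} (hv : v₁ ≤ v₂) :
    Monotone fun u => F u v₁ - F u v₂ :=
  fun _ _ hu => by have := hF.sub_anti hu hv; dsimp only; linarith

theorem neg_jumpAt_sub_neg_jumpAt (hF : RankLike F) (a v₁ v₂ : ℝ) :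
    -jumpAt (fun u => F u v₂) a - -jumpAt (fun u => F u v₁) a =
      jumpAt (fun u => F u v₁ - F u v₂) a := by
  rw [jumpAt_sub (hF.mono_left v₁) (hF.mono_left v₂)]
  ring

theorem sum_cornerMult_le (hF : RankLike F) {T : Finset (ℝ × ℝ)} {u₁ u₂ v₁ v₂ : ℝ}
    (hu : u₁ ≤ u₂) (hv : v₁ ≤ v₂) (hT : ↑T ⊆ Ioo u₁ u₂ ×ˢ Ioo v₁ v₂) :
    ∑ x ∈ T, cornerMult F x.1 x.2 ≤ boxSum F u₁ u₂ v₁ v₂ := by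
  classical
  have hA : (↑(T.image Prod.fst) : Set ℝ) ⊆ Ioo u₁ u₂ := by
    rw [Finset.coe_image, image_subset_iff]
    exact fun x hx => (hT hx).1
  have hB : (↑(T.image Prod.snd) : Set ℝ) ⊆ Ioo v₁ v₂ := by
    rw [Finset.coe_image, image_subset_iff]
    exact fun x hx => (hT hx).2
  calc ∑ x ∈ T, cornerMult F x.1 x.2
      ≤ ∑ x ∈ T.image Prod.fst ×ˢ T.image Prod.snd, cornerMult F x.1 x.2 :=
        Finset.sum_le_sum_of_subset_of_nonneg Finset.subset_product
          fun x _ _ => hF.cornerMult_nonneg x.1 x.2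
    _ = ∑ a ∈ T.image Prod.fst, ∑ b ∈ T.image Prod.snd, cornerMult F a b := Finset.sum_product ..
    _ ≤ ∑ a ∈ T.image Prod.fst, jumpAt (fun u => F u v₁ - F u v₂) a :=
        Finset.sum_le_sum fun a _ => (sum_jumpAt_le (hF.monotone_neg_jumpAt a) _ hv hB).trans_eq
          (hF.neg_jumpAt_sub_neg_jumpAt a v₁ v₂)
    _ ≤ F u₂ v₁ - F u₂ v₂ - (F u₁ v₁ - F u₁ v₂) := sum_jumpAt_le (hF.monotone_sub hv) _ hu hA
    _ = boxSum F u₁ u₂ v₁ v₂ := by rw [boxSum]; ring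

theorem exists_boxSum_le_sum_cornerMult (hF : RankLike F) {u₁ u₂ v₁ v₂ : ℝ} (hu : u₁ ≤ u₂)
    (hv : v₁ ≤ v₂) : ∃ T : Finset (ℝ × ℝ), ↑T ⊆ Icc u₁ u₂ ×ˢ Icc v₁ v₂ ∧
      boxSum F u₁ u₂ v₁ v₂ ≤ ∑ x ∈ T, cornerMult F x.1 x.2 := by
  classical
  obtain ⟨A, hA, hAsum⟩ := exists_sub_le_sum_jumpAt (hF.monotone_sub hv) hu
  choose B hB hBsum using fun a => exists_sub_le_sum_jumpAt (hF.monotone_neg_jumpAt a) hv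
  refine ⟨A ×ˢ A.biUnion B, ?_, ?_⟩
  · rw [Finset.coe_product]
    refine prod_mono hA fun b hb => ?_
    obtain ⟨a, -, hb⟩ := Finset.mem_biUnion.1 hb
    exact hB a hb
  · calc boxSum F u₁ u₂ v₁ v₂ = F u₂ v₁ - F u₂ v₂ - (F u₁ v₁ - F u₁ v₂) := by rw [boxSum]; ring
      _ ≤ ∑ a ∈ A, jumpAt (fun u => F u v₁ - F u v₂) a := hAsum
      _ ≤ ∑ a ∈ A, ∑ b ∈ B a, cornerMult F a b :=
          Finset.sum_le_sum fun a _ =>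
            (hF.neg_jumpAt_sub_neg_jumpAt a v₁ v₂).symm.trans_le (hBsum a)
      _ ≤ ∑ a ∈ A, ∑ b ∈ A.biUnion B, cornerMult F a b :=
          Finset.sum_le_sum fun a ha => Finset.sum_le_sum_of_subset_of_nonneg
            (Finset.subset_biUnion_of_mem B ha) fun b _ _ => hF.cornerMult_nonneg a b
      _ = ∑ x ∈ A ×ˢ A.biUnion B, cornerMult F x.1 x.2 := by rw [Finset.sum_product]

end RankLike

/-! ### Moving points with multiplicities -/

theorem sum_biUnion_le_sum_sum {ι κ : Type*} [DecidableEq κ] (P : Finset ι) (A : ι → Finset κ)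
    (f : κ → ℕ) : ∑ y ∈ P.biUnion A, f y ≤ ∑ p ∈ P, ∑ y ∈ A p, f y := by
  classical
  induction P using Finset.induction_on with
  | empty => simp
  | insert p P hp ih =>
    rw [Finset.biUnion_insert, Finset.sum_insert hp]
    have := Finset.sum_union_inter (s₁ := A p) (s₂ := P.biUnion A) (f := f)
    lia

theorem finite_ne_zero_of_sum_le {Y : Type*} {m : Y → ℕ} {V : Set Y} {N : ℕ}
    (h : ∀ T : Finset Y, ↑T ⊆ V → ∑ y ∈ T, m y ≤ N) : {y ∈ V | m y ≠ 0}.Finite := by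
  by_contra hinf
  obtain ⟨T, hT, hcard⟩ := Set.Infinite.exists_subset_card_eq hinf (N + 1)
  have hle : T.card ≤ ∑ y ∈ T, m y := by
    rw [Finset.card_eq_sum_ones]
    exact Finset.sum_le_sum fun y hy => Nat.one_le_iff_ne_zero.2 (hT hy).2
  have hN := h T fun y hy => (hT hy).1
  lia

/-- Hall's marriage theorem for points with multiplicities. -/
theorem exists_injective_sigma_fin {X Y : Type*} {m : X → ℕ} {m' : Y → ℕ} {N : X → Set Y}
    (hfin : ∀ x, {y ∈ N x | m' y ≠ 0}.Finite)
    (hsum : ∀ K : Finset X, ∃ T : Finset Y, ↑T ⊆ ⋃ x ∈ K, N x ∧ ∑ x ∈ K, m x ≤ ∑ y ∈ T, m' y) :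
    ∃ φ : (Σ x, Fin (m x)) → Σ y, Fin (m' y), Function.Injective φ ∧ ∀ e, (φ e).1 ∈ N e.1 := by
  classical
  have hfin' (e : Σ x, Fin (m x)) : {z : Σ y, Fin (m' y) | z.1 ∈ N e.1}.Finite :=
    ((hfin e.1).biUnion (t := fun y => range (Sigma.mk y)) fun y _ => finite_range _).subset
      fun z hz => mem_iUnion₂.2 ⟨z.1, ⟨hz, z.2.pos.ne'⟩, z.2, rfl⟩
  obtain ⟨φ, hφ, hφN⟩ := (Finset.all_card_le_biUnion_card_iff_exists_injective
    fun e => (hfin' e).toFinset).1 fun A => by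
      obtain ⟨T, hT, hsumT⟩ := hsum (A.image Sigma.fst)
      calc A.card ≤ ((A.image Sigma.fst).sigma fun _ => Finset.univ).card :=
            Finset.card_le_card fun e he => Finset.mem_sigma.2
              ⟨Finset.mem_image_of_mem _ he, Finset.mem_univ _⟩
        _ = ∑ x ∈ A.image Sigma.fst, m x := by simp [Finset.card_sigma]
        _ ≤ ∑ y ∈ T, m' y := hsumT
        _ = (T.sigma fun y => (Finset.univ : Finset (Fin (m' y)))).card := by
            simp [Finset.card_sigma]
        _ ≤ _ := Finset.card_le_card fun z hz => by
            obtain ⟨x, hx, hzx⟩ := mem_iUnion₂.1 (hT (Finset.mem_sigma.1 hz).1)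
            obtain ⟨e, he, rfl⟩ := Finset.mem_image.1 hx
            exact Finset.mem_biUnion.2 ⟨e, he, by simpa using hzx⟩
  exact ⟨φ, hφ, fun e => by simpa using hφN e⟩

/-- Points of `Y` with multiplicities `m t` depending on a time `t`. As long as they are in `U`
they move with speed at most `h`: none appear suddenly (`upper`), and each can be followed for a
short time (`lower`). -/
structure BoundedMotion {Y : Type*} [PseudoMetricSpace Y] (m : ℝ → Y → ℕ) (U : Set Y) (h : ℝ) :
    Prop where
  upper : ∀ t, ∀ p ∈ U, ∃ V ∈ 𝓝 p, ∀ᶠ s in 𝓝 t, ∀ T : Finset Y, ↑T ⊆ V → ∑ y ∈ T, m s y ≤ m t p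
  lower : ∀ t, ∀ p ∈ U, ∀ᶠ s in 𝓝[>] t, ∃ T : Finset Y,
    ↑T ⊆ Metric.closedBall p ((s - t) * h) ∧ m t p ≤ ∑ y ∈ T, m s y

namespace BoundedMotion

variable {Y : Type*} [MetricSpace Y] {m : ℝ → Y → ℕ} {U : Set Y} {h : ℝ}

theorem eventually_forall_sum_le (hm : BoundedMotion m U h) (t : ℝ) {C : Set Y} (hC : IsCompact C)
    (hCU : C ⊆ U) : ∃ P : Finset Y, ↑P ⊆ C ∧
      ∀ᶠ s in 𝓝 t, ∀ T : Finset Y, ↑T ⊆ C → ∑ y ∈ T, m s y ≤ ∑ p ∈ P, m t p := by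
  classical
  choose! V hV hup using fun p (hp : p ∈ C) => hm.upper t p (hCU hp)
  obtain ⟨P, hPC, hcov⟩ := hC.elim_nhds_subcover V hV
  refine ⟨P, hPC, ?_⟩
  filter_upwards [(Filter.eventually_all_finset P).2 fun p hp => hup p (hPC p hp)] with s hs T hT
  have hsub : T ⊆ P.biUnion fun p => T.filter (· ∈ V p) := fun y hy => by
    obtain ⟨p, hp, hyp⟩ := mem_iUnion₂.1 (hcov (hT hy))
    exact Finset.mem_biUnion.2 ⟨p, hp, Finset.mem_filter.2 ⟨hy, hyp⟩⟩
  calc ∑ y ∈ T, m s y ≤ ∑ y ∈ P.biUnion fun p => T.filter (· ∈ V p), m s y :=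
        Finset.sum_le_sum_of_subset hsub
    _ ≤ ∑ p ∈ P, ∑ y ∈ T with y ∈ V p, m s y := sum_biUnion_le_sum_sum ..
    _ ≤ ∑ p ∈ P, m t p := Finset.sum_le_sum fun p hp =>
        hs p hp _ fun y hy => (Finset.mem_filter.1 hy).2

theorem finite_ne_zero (hm : BoundedMotion m U h) (t : ℝ) {C : Set Y} (hC : IsCompact C)
    (hCU : C ⊆ U) : {y ∈ C | m t y ≠ 0}.Finite :=
  have ⟨_, _, hP⟩ := hm.eventually_forall_sum_le t hC hCU
  finite_ne_zero_of_sum_le hP.self_of_nhds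

theorem countable_ne_zero [SecondCountableTopology Y] (hm : BoundedMotion m U h) (t : ℝ) :
    {y ∈ U | m t y ≠ 0}.Countable := by
  choose! V hV hup using hm.upper t
  obtain ⟨P, hPU, hP, hcov⟩ :=
    TopologicalSpace.countable_cover_nhdsWithin fun p hp => mem_nhdsWithin_of_mem_nhds (hV p hp)
  refine (hP.biUnion (t := fun p _ => {y ∈ V p | m t y ≠ 0}) fun p hp =>
    (finite_ne_zero_of_sum_le (hup p (hPU hp)).self_of_nhds).countable).mono fun y hy => ?_
  obtain ⟨p, hp, hyp⟩ := mem_iUnion₂.1 (hcov hy.1)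
  exact mem_iUnion₂.2 ⟨p, hp, hyp, hy.2⟩

theorem eventually_exists_sum_le (hm : BoundedMotion m U h) (t : ℝ) {K : Finset Y}
    (hK : ↑K ⊆ U) : ∀ᶠ s in 𝓝[>] t, ∃ T : Finset Y,
      ↑T ⊆ Metric.cthickening ((s - t) * h) (K : Set Y) ∧ ∑ x ∈ K, m t x ≤ ∑ y ∈ T, m s y := by
  classical
  have hsep : ∀ᶠ s in 𝓝[>] t, ∀ z ∈ K.offDiag, (s - t) * h + (s - t) * h < dist z.1 z.2 := by
    refine (Filter.eventually_all_finset _).2 fun z hz => nhdsWithin_le_nhds ?_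
    refine (show Continuous fun s : ℝ => (s - t) * h + (s - t) * h by fun_prop).continuousAt
      |>.eventually_lt continuousAt_const ?_
    simpa using (Finset.mem_offDiag.1 hz).2.2
  have hlow : ∀ᶠ s in 𝓝[>] t, ∀ x ∈ K, _ :=
    (Filter.eventually_all_finset K).2 fun x hx => hm.lower t x (hK hx)
  filter_upwards [hsep, hlow] with s hs hlow
  choose! T hT hsum using hlow
  refine ⟨K.biUnion T, fun y hy => ?_, ?_⟩
  · obtain ⟨x, hx, hy⟩ := Finset.mem_biUnion.1 hy
    exact Metric.closedBall_subset_cthickening hx _ (hT x hx hy)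
  · rw [Finset.sum_biUnion fun x hx x' hx' hne => ?_]
    · exact Finset.sum_le_sum hsum
    · rw [onFun, ← Finset.disjoint_coe]
      exact (Metric.closedBall_disjoint_closedBall
        (hs (x, x') (Finset.mem_offDiag.2 ⟨hx, hx', hne⟩))).mono (hT x hx) (hT x' hx')

variable [ProperSpace Y]

theorem exists_sum_le (hm : BoundedMotion m U h) (hh : 0 ≤ h) {a b : ℝ} (hab : a ≤ b)
    {K : Finset Y} (hK : Metric.cthickening ((b - a) * h) (K : Set Y) ⊆ U) :
    ∃ T : Finset Y, ↑T ⊆ Metric.cthickening ((b - a) * h) (K : Set Y) ∧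
      ∑ x ∈ K, m a x ≤ ∑ y ∈ T, m b y := by
  have hthick {s t : ℝ} (hst : s ≤ t) : Metric.cthickening ((s - a) * h) (K : Set Y) ⊆
      Metric.cthickening ((t - a) * h) K :=
    Metric.cthickening_mono (by gcongr) _
  refine Icc_induction_of_frequently_left
    (P := fun t => ∃ T : Finset Y, ↑T ⊆ Metric.cthickening ((t - a) * h) (K : Set Y) ∧
      ∑ x ∈ K, m a x ≤ ∑ y ∈ T, m t y)
    hab ⟨K, Metric.self_subset_cthickening _, le_rfl⟩ (fun t ht hfreq => ?_) (fun t ht hPt => ?_)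
  · obtain ⟨P, hP, hev⟩ := hm.eventually_forall_sum_le t
      (K.finite_toSet.isCompact.cthickening (r := (t - a) * h)) ((hthick ht.2).trans hK)
    obtain ⟨s, ⟨T, hT, hsum⟩, hs, hst⟩ :=
      (hfreq.and_eventually ((hev.filter_mono nhdsWithin_le_nhds).and self_mem_nhdsWithin)).exists
    exact ⟨P, hP, hsum.trans (hs T (hT.trans (hthick (mem_Iio.1 hst).le)))⟩
  · obtain ⟨T, hT, hsum⟩ := hPt
    obtain ⟨s, ⟨T', hT', hsum'⟩, hs⟩ :=
      ((hm.eventually_exists_sum_le t (hT.trans ((hthick ht.2.le).trans hK))).and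
        (Ioc_mem_nhdsGT ht.2)).exists
    refine ⟨s, hs, T', hT'.trans ?_, hsum.trans hsum'⟩
    have hadd : (s - a) * h = (s - t) * h + (t - a) * h := by ring
    rw [hadd]
    exact (Metric.cthickening_subset_of_subset _ hT).trans
      (Metric.cthickening_cthickening_subset (mul_nonneg (sub_nonneg.2 hs.1.le) hh)
        (mul_nonneg (sub_nonneg.2 ht.1) hh) _)

theorem exists_injective (hm : BoundedMotion m U h) (hh : 0 ≤ h) {a b : ℝ} (hab : a ≤ b) :
    ∃ φ : {e : Σ x, Fin (m a x) // Metric.closedBall e.1 ((b - a) * h) ⊆ U} → Σ y, Fin (m b y),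
      Function.Injective φ ∧ ∀ e, dist (φ e).1 e.1.1 ≤ (b - a) * h := by
  have hr : 0 ≤ (b - a) * h := mul_nonneg (sub_nonneg.2 hab) hh
  obtain ⟨φ, hφ, hφd⟩ := exists_injective_sigma_fin
    (m := fun x : {x // Metric.closedBall x ((b - a) * h) ⊆ U} => m a x)
    (fun x => hm.finite_ne_zero b (isCompact_closedBall _ _) x.2) fun K => by
      have hthick : Metric.cthickening ((b - a) * h) (K.map (.subtype _) : Set Y) =
          ⋃ x ∈ K, Metric.closedBall (x : Y) ((b - a) * h) := by
        rw [(Finset.finite_toSet _).isCompact.cthickening_eq_biUnion_closedBall hr,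
          Finset.coe_map, biUnion_image]
        rfl
      obtain ⟨T, hT, hsum⟩ := hm.exists_sum_le hh hab
        (hthick.trans_subset (iUnion₂_subset fun x _ => x.2))
      exact ⟨T, hT.trans_eq hthick, by simpa using hsum⟩
  let σ := Equiv.subtypeSigmaEquiv (fun x => Fin (m a x))
    fun x => Metric.closedBall x ((b - a) * h) ⊆ U
  exact ⟨φ ∘ σ, hφ.comp σ.injective, fun e => hφd (σ e)⟩

end BoundedMotion

/-! ### Multiplicities as jumps -/

theorem sInf_natCast_mem_eq_of_isLeast {A : Set ℤ} {c : ℤ} (hA : IsLeast A c) (hc : 0 ≤ c) :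
    ((sInf {n : ℕ | (n : ℤ) ∈ A} : ℕ) : ℤ) = c := by
  lift c to ℕ using hc
  have hleast : IsLeast {n : ℕ | (n : ℤ) ∈ A} c :=
    ⟨hA.1, fun n hn => Int.ofNat_le.1 (hA.2 (show (n : ℤ) ∈ A from hn))⟩
  rw [hleast.csInf_eq]

namespace CategoricalPersistenceFunction

variable (q : CategoricalPersistenceFunction ℝ)

theorem at_of_le {u v : ℝ} (h : u ≤ v) : q.at u v = q.val (homOfLE h) := dif_pos h

theorem at_mono_left {u u' v : ℝ} (h : u ≤ u') (h' : u' ≤ v) : q.at u v ≤ q.at u' v := by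
  rw [q.at_of_le h', q.at_of_le (h.trans h')]
  exact q.le_left (homOfLE h) (homOfLE h')

theorem at_anti_right {u v v' : ℝ} (h : u ≤ v) (h' : v ≤ v') : q.at u v' ≤ q.at u v := by
  rw [q.at_of_le h, q.at_of_le (h.trans h')]
  exact q.le_right (homOfLE h) (homOfLE h')

theorem at_sub_le {u u' v v' : ℝ} (h₁ : u ≤ u') (h₂ : u' ≤ v) (h₃ : v ≤ v') :
    q.at u' v' - q.at u v' ≤ q.at u' v - q.at u v := by
  rw [q.at_of_le h₂, q.at_of_le (h₁.trans h₂), q.at_of_le (h₂.trans h₃),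
    q.at_of_le (h₁.trans (h₂.trans h₃))]
  exact q.sub_ge_sub (homOfLE h₁) (homOfLE h₂) (homOfLE h₃)

/-- The extension to the whole plane of the restriction of `q` to the quadrant `u ≤ w ≤ v`, which
is constant along the rays leaving this quadrant. -/
noncomputable def clamp (w u v : ℝ) : ℤ := q.at (min u w) (max v w)

theorem rankLike_clamp (w : ℝ) : RankLike (q.clamp w) where
  mono_left _ _ _ h := q.at_mono_left (min_le_min_right w h)
    ((min_le_right _ _).trans (le_max_right _ _))
  anti_right _ _ _ h := q.at_anti_right ((min_le_right _ _).trans (le_max_right _ _))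
    (max_le_max_right w h)
  sub_anti h h' := q.at_sub_le (min_le_min_right w h)
    ((min_le_right _ _).trans (le_max_right _ _)) (max_le_max_right w h')

theorem clamp_of_le {w u v : ℝ} (h : u ≤ w) (h' : w ≤ v) : q.clamp w u v = q.at u v := by
  rw [clamp, min_eq_left h, max_eq_left h']

theorem boxSum_clamp {w u₁ u₂ v₁ v₂ : ℝ} (h₁ : u₁ ≤ u₂) (h₂ : u₂ ≤ w) (h₃ : w ≤ v₁)
    (h₄ : v₁ ≤ v₂) : boxSum (q.clamp w) u₁ u₂ v₁ v₂ = boxSum q.at u₁ u₂ v₁ v₂ := by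
  simp only [boxSum]
  rw [q.clamp_of_le h₂ h₃, q.clamp_of_le (h₁.trans h₂) h₃, q.clamp_of_le h₂ (h₃.trans h₄),
    q.clamp_of_le (h₁.trans h₂) (h₃.trans h₄)]

theorem boxSum_at_mono {u₁ u₂ v₁ v₂ u₁' u₂' v₁' v₂' : ℝ} (hu₁ : u₁' ≤ u₁) (hu : u₁ ≤ u₂)
    (hu₂ : u₂ ≤ u₂') (huv : u₂' ≤ v₁') (hv₁ : v₁' ≤ v₁) (hv : v₁ ≤ v₂) (hv₂ : v₂ ≤ v₂') :
    boxSum q.at u₁ u₂ v₁ v₂ ≤ boxSum q.at u₁' u₂' v₁' v₂' := by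
  rw [← q.boxSum_clamp hu hu₂ (huv.trans hv₁) hv,
    ← q.boxSum_clamp (hu₁.trans (hu.trans hu₂)) le_rfl huv (hv₁.trans (hv.trans hv₂))]
  exact (q.rankLike_clamp u₂').boxSum_mono hu₁ hu hu₂ hv₁ hv hv₂

theorem eventually_boxSum_at_eq_cornerMult {a b w : ℝ} (ha : a < w) (hb : w < b) :
    ∀ᶠ r in 𝓝[>] 0, boxSum q.at (a - r) (a + r) (b - r) (b + r) = cornerMult (q.clamp w) a b := by
  filter_upwards [(q.rankLike_clamp w).eventually_boxSum_eq_cornerMult a b,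
    Ioc_mem_nhdsGT (sub_pos.2 ha), Ioc_mem_nhdsGT (sub_pos.2 hb)] with r hr hra hrb
  rw [← hr, q.boxSum_clamp] <;> linarith [hra.1, hra.2, hrb.2]

theorem properMult_eq_cornerMult_clamp {a b w : ℝ} (ha : a < w) (hb : w < b) :
    (q.properMult a b : ℤ) = cornerMult (q.clamp w) a b := by
  have hev := q.eventually_boxSum_at_eq_cornerMult ha hb
  refine sInf_natCast_mem_eq_of_isLeast
    (A := {n | ∃ ε, 0 < ε ∧ a + ε < b - ε ∧ n = boxSum q.at (a - ε) (a + ε) (b - ε) (b + ε)})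
    ⟨?_, ?_⟩ ((q.rankLike_clamp w).cornerMult_nonneg a b)
  · obtain ⟨ε, hε, hε'⟩ :=
      (hev.and (Ioo_mem_nhdsGT (half_pos (sub_pos.2 (ha.trans hb))))).exists
    exact ⟨ε, hε'.1, by linarith [hε'.2], hε.symm⟩
  · rintro _ ⟨ε, hε, hεab, rfl⟩
    obtain ⟨r, hr, hrε⟩ := (hev.and (Ioc_mem_nhdsGT hε)).exists
    rw [← hr]
    apply q.boxSum_at_mono <;> linarith [hrε.1, hrε.2]

theorem sum_properMult_le {T : Finset (ℝ × ℝ)} {u₁ u₂ v₁ v₂ : ℝ} (hu : u₁ ≤ u₂) (huv : u₂ ≤ v₁)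
    (hv : v₁ ≤ v₂) (hT : ↑T ⊆ Ioo u₁ u₂ ×ˢ Ioo v₁ v₂) :
    ∑ x ∈ T, (q.properMult x.1 x.2 : ℤ) ≤ boxSum q.at u₁ u₂ v₁ v₂ := by
  rw [← q.boxSum_clamp hu le_rfl huv hv, Finset.sum_congr rfl fun x hx =>
    q.properMult_eq_cornerMult_clamp (hT hx).1.2 (huv.trans_lt (hT hx).2.1)]
  exact (q.rankLike_clamp u₂).sum_cornerMult_le hu hv hT

theorem exists_boxSum_le_sum_properMult {u₁ u₂ v₁ v₂ : ℝ} (hu : u₁ ≤ u₂) (huv : u₂ < v₁)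
    (hv : v₁ ≤ v₂) : ∃ T : Finset (ℝ × ℝ), ↑T ⊆ Icc u₁ u₂ ×ˢ Icc v₁ v₂ ∧
      boxSum q.at u₁ u₂ v₁ v₂ ≤ ∑ x ∈ T, (q.properMult x.1 x.2 : ℤ) := by
  obtain ⟨w, huw, hwv⟩ := exists_between huv
  obtain ⟨T, hT, hsum⟩ := (q.rankLike_clamp w).exists_boxSum_le_sum_cornerMult hu hv
  refine ⟨T, hT, ?_⟩
  rwa [← q.boxSum_clamp hu huw.le hwv.le hv, Finset.sum_congr rfl fun x hx =>
    q.properMult_eq_cornerMult_clamp ((hT hx).1.2.trans_lt huw) (hwv.trans_le (hT hx).2.1)]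

/-- The limit of `q.at u v` as `v` tends to infinity. The maximum keeps the second argument in the
region where `q.at` is not a junk value. -/
noncomputable def limTop (u : ℝ) : ℤ := ⨅ v, q.at u (max u v)

theorem eventually_at_eq_limTop (u : ℝ) : ∀ᶠ v in atTop, q.at u v = q.limTop u := by
  have hanti : Antitone fun v => q.at u (max u v) := fun v v' hv =>
    q.at_anti_right (le_max_left u v) (max_le_max_left u hv)
  have hbdd : BddBelow (range fun v => q.at u (max u v)) := by
    obtain ⟨m, hm⟩ := q.lowerBounded
    refine ⟨m, forall_mem_range.2 fun v => ?_⟩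
    rw [q.at_of_le (le_max_left u v)]
    exact hm _
  have hlim := tendsto_atTop_ciInf hanti hbdd
  rw [nhds_discrete, tendsto_pure] at hlim
  filter_upwards [hlim, eventually_ge_atTop u] with v hv huv
  rwa [max_eq_right huv] at hv

theorem monotone_limTop : Monotone q.limTop := by
  intro u u' h
  obtain ⟨v, hv, hv', huv⟩ := ((q.eventually_at_eq_limTop u).and
    ((q.eventually_at_eq_limTop u').and (eventually_ge_atTop u'))).exists
  rw [← hv, ← hv']
  exact q.at_mono_left h huv

theorem limTop_sub_le {u u' v : ℝ} (h : u ≤ u') (h' : u' ≤ v) :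
    q.limTop u' - q.limTop u ≤ q.at u' v - q.at u v := by
  obtain ⟨x, hx, hx', hvx⟩ := ((q.eventually_at_eq_limTop u).and
    ((q.eventually_at_eq_limTop u').and (eventually_ge_atTop v))).exists
  rw [← hx, ← hx']
  exact q.at_sub_le h h' hvx

theorem infiniteMult_eq_jumpAt_limTop (a : ℝ) : (q.infiniteMult a : ℤ) = jumpAt q.limTop a := by
  refine sInf_natCast_mem_eq_of_isLeast
    (A := {n | ∃ ε v, 0 < ε ∧ a + ε < v ∧ n = q.at (a + ε) v - q.at (a - ε) v})
    ⟨?_, ?_⟩ (jumpAt_nonneg q.monotone_limTop a)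
  · obtain ⟨ε, hε, hε0⟩ :=
      ((eventually_sub_eq_jumpAt q.monotone_limTop a).and self_mem_nhdsWithin).exists
    obtain ⟨v, hv, hv', hεv⟩ := ((q.eventually_at_eq_limTop (a + ε)).and
      ((q.eventually_at_eq_limTop (a - ε)).and (eventually_gt_atTop (a + ε)))).exists
    exact ⟨ε, v, hε0, hεv, by rw [hv, hv', hε]⟩
  · rintro _ ⟨ε, v, hε, hεv, rfl⟩
    have hjump := sum_jumpAt_le q.monotone_limTop {a} (α := a - ε) (β := a + ε) (by linarith)
      (by simp [hε])
    rw [Finset.sum_singleton] at hjump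
    exact hjump.trans (q.limTop_sub_le (by linarith) hεv.le)

/-! ### Interleavings -/

/-- Two persistence functions are `η`-interleaved if each one bounds the other after enlarging the
interval by `η` on both sides. This is the relation which balancedness provides. -/
def Interleaved (q q' : CategoricalPersistenceFunction ℝ) (η : ℝ) : Prop :=
  ∀ u v, u < v → q.at (u - η) (v + η) ≤ q'.at u v ∧ q'.at (u - η) (v + η) ≤ q.at u v

namespace Interleaved

variable {q} {q' : CategoricalPersistenceFunction ℝ} {η : ℝ}

theorem refl (q : CategoricalPersistenceFunction ℝ) : Interleaved q q 0 :=
  fun u v _ => by simp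

theorem symm (h : Interleaved q q' η) : Interleaved q' q η := fun u v huv => (h u v huv).symm

theorem at_eq (h : Interleaved q q' η) {u v : ℝ} {c : ℤ} (hη : 0 ≤ η) (huv : u + η < v - η)
    (hout : q.at (u - η) (v + η) = c) (hin : q.at (u + η) (v - η) = c) : q'.at u v = c := by
  have hle := (h (u + η) (v - η) huv).2
  rw [add_sub_cancel_right, sub_add_cancel, hin] at hle
  exact hle.antisymm (hout ▸ (h u v (by linarith)).1)

theorem limTop_le (h : Interleaved q q' η) (u : ℝ) : q.limTop (u - η) ≤ q'.limTop u := by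
  obtain ⟨v, hv, hv', huv⟩ := ((tendsto_atTop_add_const_right atTop η tendsto_id).eventually
    (q.eventually_at_eq_limTop (u - η)) |>.and
      ((q'.eventually_at_eq_limTop u).and (eventually_gt_atTop u))).exists
  rw [← hv, ← hv']
  exact (h u v huv).1

theorem limTop_eq (h : Interleaved q q' η) {u : ℝ} {c : ℤ} (hl : q.limTop (u - η) = c)
    (hr : q.limTop (u + η) = c) : q'.limTop u = c := by
  have hle := h.symm.limTop_le (u + η)
  rw [add_sub_cancel_right, hr] at hle
  exact hle.antisymm (hl ▸ h.limTop_le u)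

end Interleaved

/-- A box of half-width `σ > η` around `(a, b)` is so large that interleaving does not disturb the
values at its corners, and so small that it sees no other point of the diagram. -/
theorem eventually_forall_boxSum_eq_properMult {a b : ℝ} (hab : a < b) :
    ∀ᶠ r in 𝓝[>] 0, ∀ q' η σ, 0 ≤ η → Interleaved q q' η → η < σ → σ + η ≤ r →
      boxSum q'.at (a - σ) (a + σ) (b - σ) (b + σ) = q.properMult a b := by
  obtain ⟨w, haw, hwb⟩ := exists_between hab
  filter_upwards [(q.rankLike_clamp w).eventually_isQuadrantConst a b,
    (q.rankLike_clamp w).eventually_boxSum_eq_cornerMult a b, Ioo_mem_nhdsGT (sub_pos.2 haw),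
    Ioo_mem_nhdsGT (sub_pos.2 hwb)] with r hquad hbox hra hrb q' η σ hη hq hησ hσr
  have corner {u v : ℝ} {c : ℤ} (hu : u + η < w) (hv : w < v - η)
      (hout : q.clamp w (u - η) (v + η) = c) (hin : q.clamp w (u + η) (v - η) = c) :
      q'.at u v = c := by
    rw [q.clamp_of_le (by linarith) (by linarith)] at hout hin
    exact hq.at_eq hη (hu.trans hv) hout hin
  have ha := hra.2
  have hb := hrb.2
  rw [q.properMult_eq_cornerMult_clamp haw hwb, ← hbox, boxSum, boxSum,
    corner (u := a + σ) (v := b - σ) (by linarith) (by linarith)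
      (hquad.right_below _ ⟨by linarith, by linarith⟩ _ ⟨by linarith, by linarith⟩)
      (hquad.right_below _ ⟨by linarith, by linarith⟩ _ ⟨by linarith, by linarith⟩),
    corner (u := a - σ) (v := b - σ) (by linarith) (by linarith)
      (hquad.left_below _ ⟨by linarith, by linarith⟩ _ ⟨by linarith, by linarith⟩)
      (hquad.left_below _ ⟨by linarith, by linarith⟩ _ ⟨by linarith, by linarith⟩),
    corner (u := a + σ) (v := b + σ) (by linarith) (by linarith)
      (hquad.right_above _ ⟨by linarith, by linarith⟩ _ ⟨by linarith, by linarith⟩)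
      (hquad.right_above _ ⟨by linarith, by linarith⟩ _ ⟨by linarith, by linarith⟩),
    corner (u := a - σ) (v := b + σ) (by linarith) (by linarith)
      (hquad.left_above _ ⟨by linarith, by linarith⟩ _ ⟨by linarith, by linarith⟩)
      (hquad.left_above _ ⟨by linarith, by linarith⟩ _ ⟨by linarith, by linarith⟩)]

theorem eventually_forall_limTop_sub_eq_infiniteMult (a : ℝ) :
    ∀ᶠ r in 𝓝[>] 0, ∀ q' η σ, 0 ≤ η → Interleaved q q' η → η < σ → σ + η ≤ r →
      q'.limTop (a + σ) - q'.limTop (a - σ) = q.infiniteMult a := by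
  filter_upwards [eventually_constNear (q.monotone_limTop.tendsto_rightLim a)
    (q.monotone_limTop.tendsto_leftLim a)] with r hr q' η σ hη hq hησ hσr
  rw [q.infiniteMult_eq_jumpAt_limTop, jumpAt,
    hq.limTop_eq (hr.right _ ⟨by linarith, by linarith⟩) (hr.right _ ⟨by linarith, by linarith⟩),
    hq.limTop_eq (hr.left _ ⟨by linarith, by linarith⟩) (hr.left _ ⟨by linarith, by linarith⟩)]

/-- A path of persistence functions which is Lipschitz for interleavings, with constant `k`. -/
def IsInterleavedPath (q : ℝ → CategoricalPersistenceFunction ℝ) (k : ℝ) : Prop :=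
  ∀ s t, Interleaved (q s) (q t) (|s - t| * k)

namespace IsInterleavedPath

variable {q : ℝ → CategoricalPersistenceFunction ℝ} {k h : ℝ}

theorem boundedMotion_properMult (hq : IsInterleavedPath q k) (hk : 0 ≤ k) (hkh : k < h) :
    BoundedMotion (fun t (x : ℝ × ℝ) => (q t).properMult x.1 x.2) {x | x.1 < x.2} h where
  upper t p hp := by
    obtain ⟨r, hr, hr0⟩ := (((q t).eventually_forall_boxSum_eq_properMult hp).and
      (Ioc_mem_nhdsGT (sub_pos.2 hp))).exists
    have hr1 := hr0.1
    refine ⟨Ioo (p.1 - r / 2) (p.1 + r / 2) ×ˢ Ioo (p.2 - r / 2) (p.2 + r / 2),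
      prod_mem_nhds (Ioo_mem_nhds (by linarith) (by linarith))
        (Ioo_mem_nhds (by linarith) (by linarith)), ?_⟩
    have hclose : ∀ᶠ s in 𝓝 t, |t - s| * k < r / 2 :=
      (show Continuous fun s => |t - s| * k by fun_prop).continuousAt.eventually_lt
        continuousAt_const (by simpa using hr1)
    filter_upwards [hclose] with s hs T hT
    have hsum := (q s).sum_properMult_le (by linarith) (by linarith [hr0.2]) (by linarith) hT
    rw [hr (q s) _ (r / 2) (by positivity) (hq t s) hs (by linarith)] at hsum
    exact_mod_cast hsum
  lower t p hp := by
    obtain ⟨r, hr, hr0⟩ := (((q t).eventually_forall_boxSum_eq_properMult hp).and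
      (Ioo_mem_nhdsGT (half_pos (sub_pos.2 hp)))).exists
    have hclose : ∀ᶠ s in 𝓝[>] t, (s - t) * h + (s - t) * k < r := nhdsWithin_le_nhds <|
      (show Continuous fun s => (s - t) * h + (s - t) * k by fun_prop).continuousAt.eventually_lt
        continuousAt_const (by simpa using hr0.1)
    filter_upwards [hclose, self_mem_nhdsWithin] with s hs hts
    have hst : 0 < s - t := sub_pos.2 hts
    have hη : 0 ≤ (s - t) * k := mul_nonneg hst.le hk
    have hησ : (s - t) * k < (s - t) * h := mul_lt_mul_of_pos_left hkh hst
    obtain ⟨T, hT, hsum⟩ := (q s).exists_boxSum_le_sum_properMult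
      (u₁ := p.1 - (s - t) * h) (u₂ := p.1 + (s - t) * h) (v₁ := p.2 - (s - t) * h)
      (v₂ := p.2 + (s - t) * h) (by linarith) (by linarith [hr0.2]) (by linarith)
    rw [hr (q s) _ _ hη (by simpa [abs_sub_comm t s, abs_of_pos hst] using hq t s) hησ hs.le]
      at hsum
    refine ⟨T, ?_, by exact_mod_cast hsum⟩
    rwa [← Prod.mk.eta (p := p), ← closedBall_prod_same, Real.closedBall_eq_Icc,
      Real.closedBall_eq_Icc]

theorem boundedMotion_infiniteMult (hq : IsInterleavedPath q k) (hk : 0 ≤ k) (hkh : k < h) :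
    BoundedMotion (fun t => (q t).infiniteMult) univ h where
  upper t a _ := by
    obtain ⟨r, hr, hr0⟩ := (((q t).eventually_forall_limTop_sub_eq_infiniteMult a).and
      self_mem_nhdsWithin).exists
    have hr1 : 0 < r := hr0
    refine ⟨Ioo (a - r / 2) (a + r / 2), Ioo_mem_nhds (by linarith) (by linarith), ?_⟩
    have hclose : ∀ᶠ s in 𝓝 t, |t - s| * k < r / 2 :=
      (show Continuous fun s => |t - s| * k by fun_prop).continuousAt.eventually_lt
        continuousAt_const (by simpa using hr1)
    filter_upwards [hclose] with s hs T hT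
    have hsum := sum_jumpAt_le (q s).monotone_limTop T (by linarith) hT
    simp only [hr (q s) _ (r / 2) (by positivity) (hq t s) hs (by linarith),
      ← infiniteMult_eq_jumpAt_limTop] at hsum
    exact_mod_cast hsum
  lower t a _ := by
    obtain ⟨r, hr, hr0⟩ := (((q t).eventually_forall_limTop_sub_eq_infiniteMult a).and
      self_mem_nhdsWithin).exists
    have hclose : ∀ᶠ s in 𝓝[>] t, (s - t) * h + (s - t) * k < r := nhdsWithin_le_nhds <|
      (show Continuous fun s => (s - t) * h + (s - t) * k by fun_prop).continuousAt.eventually_lt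
        continuousAt_const (by simpa using hr0)
    filter_upwards [hclose, self_mem_nhdsWithin] with s hs hts
    have hst : 0 < s - t := sub_pos.2 hts
    have hη : 0 ≤ (s - t) * k := mul_nonneg hst.le hk
    have hησ : (s - t) * k < (s - t) * h := mul_lt_mul_of_pos_left hkh hst
    obtain ⟨T, hT, hsum⟩ := exists_sub_le_sum_jumpAt (q s).monotone_limTop
      (α := a - (s - t) * h) (β := a + (s - t) * h) (by linarith)
    simp only [hr (q s) _ _ hη (by simpa [abs_sub_comm t s, abs_of_pos hst] using hq t s) hησ hs.le,
      ← infiniteMult_eq_jumpAt_limTop] at hsum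
    refine ⟨T, ?_, by exact_mod_cast hsum⟩
    rwa [Real.closedBall_eq_Icc]

end IsInterleavedPath

end CategoricalPersistenceFunction

/-! ### Matchings of persistence diagrams -/

theorem countable_sigma_fin {Y : Type*} {m : Y → ℕ} (h : {y | m y ≠ 0}.Countable) :
    Countable (Σ y, Fin (m y)) := by
  have := h.to_subtype
  refine Function.Injective.countable
    (f := fun e => ((⟨e.1, e.2.pos.ne'⟩, e.2) : {y | m y ≠ 0} × ℕ)) ?_
  rintro ⟨y, i, hi⟩ ⟨y', i', hi'⟩ heq
  cases heq
  rfl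

theorem exists_injective_fst_eq {B X : Type*} [Countable B] (π : B → X) :
    ∃ g : B ⊕ X × ℕ → X × ℕ, Function.Injective g ∧ ∀ e, (g e).1 = Sum.elim π Prod.fst e := by
  obtain ⟨enc, henc⟩ := Countable.exists_injective_nat (B ⊕ ℕ)
  refine ⟨Sum.elim (fun b => (π b, enc (.inl b))) fun z => (z.1, enc (.inr z.2)), ?_, ?_⟩
  · rintro (b | ⟨x, n⟩) (b' | ⟨x', n'⟩) heq <;> obtain ⟨hx, hn⟩ := Prod.ext_iff.1 heq <;>
      cases henc hn
    · rfl
    · cases hx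
      rfl
  · rintro (b | z) <;> rfl

theorem dist_midpoint_diagonal_le {x : ℝ × ℝ} {h : ℝ} (hx : |x.2 - x.1| ≤ 2 * h) :
    dist ((x.1 + x.2) / 2, (x.1 + x.2) / 2) x ≤ h := by
  rw [abs_le] at hx
  rw [Prod.dist_eq, max_le_iff, Real.dist_eq, Real.dist_eq, abs_le, abs_le]
  refine ⟨⟨?_, ?_⟩, ?_, ?_⟩ <;> linarith

theorem abs_sub_le_of_not_closedBall_subset {x : ℝ × ℝ} {h : ℝ} (hx : x.1 < x.2)
    (hball : ¬Metric.closedBall x h ⊆ {y | y.1 < y.2}) : |x.2 - x.1| ≤ 2 * h := by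
  obtain ⟨y, hy, hyx⟩ := not_subset.1 hball
  rw [Metric.mem_closedBall, Prod.dist_eq, max_le_iff, Real.dist_eq, Real.dist_eq, abs_le,
    abs_le] at hy
  rw [abs_of_pos (sub_pos.2 hx)]
  linarith [not_lt.1 (show ¬y.1 < y.2 from hyx)]

/-- The underlying point of an element of a set of labelled points of the plane, enlarged by
countably many copies of the diagonal. -/
def withDiagonal {S : Type*} (x : S → ℝ × ℝ) : S ⊕ ℝ × ℕ → ℝ × ℝ :=
  Sum.elim x fun z => (z.1, z.1)

theorem exists_injective_withDiagonal {S T : Type*} [Countable S] {x : S → ℝ × ℝ}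
    {y : T → ℝ × ℝ} {h : ℝ} (hh : 0 ≤ h) {P : S → Prop} {φ : {s // P s} → T}
    (hφ : Function.Injective φ) (hφd : ∀ s, dist (y (φ s)) (x s) ≤ h)
    (hP : ∀ s, ¬P s → |(x s).2 - (x s).1| ≤ 2 * h) :
    ∃ f : S ⊕ ℝ × ℕ → T ⊕ ℝ × ℕ, Function.Injective f ∧
      ∀ e, dist (withDiagonal y (f e)) (withDiagonal x e) ≤ h := by
  classical
  obtain ⟨g, hg, hgπ⟩ := exists_injective_fst_eq fun s : {s // ¬P s} => ((x s).1 + (x s).2) / 2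
  let σ : S ⊕ ℝ × ℕ ≃ {s // P s} ⊕ ({s // ¬P s} ⊕ ℝ × ℕ) :=
    ((Equiv.sumCompl P).symm.sumCongr (.refl _)).trans (.sumAssoc _ _ _)
  refine ⟨Sum.map φ g ∘ σ, (hφ.sumMap hg).comp σ.injective, fun e => ?_⟩
  obtain ⟨e, rfl⟩ := σ.symm.surjective e
  rw [comp_apply, σ.apply_symm_apply]
  rcases e with s | s | z
  · exact hφd s
  · change dist ((g (.inl s)).1, (g (.inl s)).1) (x s) ≤ h
    rw [hgπ]
    exact dist_midpoint_diagonal_le (hP s s.2)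
  · change dist ((g (.inr z)).1, (g (.inr z)).1) (z.1, z.1) ≤ h
    rw [hgπ]
    simpa using hh

theorem pointDist_coe (x y : ℝ × ℝ) :
    pointDist (x.1, (x.2 : WithTop ℝ)) (y.1, (y.2 : WithTop ℝ)) = ENNReal.ofReal (dist x y) :=
  (ENNReal.ofReal_max _ _).symm

theorem pointDist_top (a b : ℝ) : pointDist (a, ⊤) (b, ⊤) = ENNReal.ofReal (dist a b) :=
  max_eq_left zero_le

namespace CategoricalPersistenceFunction

/-- The points at infinity of the diagram of `q`, counted with multiplicity. -/
abbrev InfinitePart (q : CategoricalPersistenceFunction ℝ) : Type := Σ a, Fin (q.infiniteMult a)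

/-- The points of the diagram of `q` off the diagonal and not at infinity, counted with
multiplicity. -/
abbrev ProperPart (q : CategoricalPersistenceFunction ℝ) : Type :=
  Σ x : ℝ × ℝ, Fin (q.properMult x.1 x.2)

section

variable (q : CategoricalPersistenceFunction ℝ)

theorem lt_of_properPart (e : q.ProperPart) : e.1.1 < e.1.2 :=
  q.lt_of_properMult_ne_zero e.2.pos.ne'

theorem diagram_mult_of_ne {a b : ℝ} (h : a ≠ b) :
    q.diagram.mult (a, (b : WithTop ℝ)) = (q.properMult a b : ℕ∞) := if_neg h

/-- The decomposition of the diagram of `q` into points at infinity, proper points and copies of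
the diagonal, as a function. -/
def elementOfSum : q.InfinitePart ⊕ (q.ProperPart ⊕ ℝ × ℕ) → q.diagram.Element
  | .inl e => ⟨(e.1, ⊤), e.2, Nat.cast_lt.2 e.2.2⟩
  | .inr (.inl e) => ⟨(e.1.1, (e.1.2 : WithTop ℝ)), e.2, by
      rw [q.diagram_mult_of_ne (q.lt_of_properPart e).ne]; exact Nat.cast_lt.2 e.2.2⟩
  | .inr (.inr z) => ⟨(z.1, (z.1 : WithTop ℝ)), z.2, by
      rw [q.diagram.diagonal]; exact ENat.natCast_lt_top z.2⟩

theorem injective_elementOfSum : Function.Injective q.elementOfSum := by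
  have hne (e : q.ProperPart) (u : ℝ) (n : ℕ) :
      q.elementOfSum (.inr (.inl e)) ≠ q.elementOfSum (.inr (.inr (u, n))) := fun heq =>
    (q.lt_of_properPart e).ne <| (congrArg (·.1.1) heq).trans
      (WithTop.coe_injective (congrArg (·.1.2) heq)).symm
  rintro (⟨a, i, hi⟩ | e | ⟨u, n⟩) (⟨a', i', hi'⟩ | e' | ⟨u', n'⟩) heq
  · cases heq; rfl
  · cases heq
  · cases heq
  · cases heq
  · obtain ⟨⟨a, b⟩, i, hi⟩ := e
    obtain ⟨⟨a', b'⟩, i', hi'⟩ := e'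
    cases heq; rfl
  · exact (hne e u' n' heq).elim
  · cases heq
  · exact (hne e' u n heq.symm).elim
  · cases heq; rfl

theorem surjective_elementOfSum : Function.Surjective q.elementOfSum := by
  rintro ⟨⟨a, b⟩, i, hi⟩
  induction b using WithTop.recTopCoe with
  | top => exact ⟨.inl ⟨a, i, Nat.cast_lt.1 hi⟩, rfl⟩
  | coe b =>
    obtain rfl | hab := eq_or_ne a b
    · exact ⟨.inr (.inr (a, i)), rfl⟩
    · exact ⟨.inr (.inl ⟨(a, b), i, Nat.cast_lt.1 (hi.trans_eq (q.diagram_mult_of_ne hab))⟩), rfl⟩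

/-- The decomposition of the diagram of `q` into points at infinity, proper points and copies of
the diagonal. -/
noncomputable def elementEquiv : q.InfinitePart ⊕ (q.ProperPart ⊕ ℝ × ℕ) ≃ q.diagram.Element :=
  .ofBijective q.elementOfSum ⟨q.injective_elementOfSum, q.surjective_elementOfSum⟩

theorem elementEquiv_inr_fst (e : q.ProperPart ⊕ ℝ × ℕ) :
    (q.elementEquiv (.inr e)).1 =
      ((withDiagonal Sigma.fst e).1, ((withDiagonal Sigma.fst e).2 : WithTop ℝ)) := by
  cases e <;> rfl

end

theorem bottleneckDist_diagram_le {q q' : CategoricalPersistenceFunction ℝ} {h : ℝ}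
    {ψ : q.InfinitePart → q'.InfinitePart} (hψ : Bijective ψ)
    (hψd : ∀ e, dist (ψ e).1 e.1 ≤ h) {φ : q.ProperPart ⊕ ℝ × ℕ → q'.ProperPart ⊕ ℝ × ℕ}
    (hφ : Bijective φ)
    (hφd : ∀ e, dist (withDiagonal Sigma.fst (φ e)) (withDiagonal Sigma.fst e) ≤ h) :
    bottleneckDist q.diagram q'.diagram ≤ ENNReal.ofReal h := by
  refine iInf_le_of_le (q.elementEquiv.symm.trans
    (((Equiv.ofBijective ψ hψ).sumCongr (.ofBijective φ hφ)).trans q'.elementEquiv))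
    (iSup_le fun e => ?_)
  obtain ⟨e | e, rfl⟩ := q.elementEquiv.surjective e
  · simp only [Equiv.trans_apply, Equiv.symm_apply_apply, Equiv.sumCongr_apply, Sum.map_inl,
      Equiv.ofBijective_apply]
    refine (pointDist_top _ _).trans_le (ENNReal.ofReal_le_ofReal ?_)
    rw [dist_comm]
    exact hψd e
  · simp only [Equiv.trans_apply, Equiv.symm_apply_apply, Equiv.sumCongr_apply, Sum.map_inr,
      Equiv.ofBijective_apply, elementEquiv_inr_fst]
    rw [pointDist_coe, dist_comm]
    exact ENNReal.ofReal_le_ofReal (hφd e)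

namespace IsInterleavedPath

variable {q : ℝ → CategoricalPersistenceFunction ℝ} {k h : ℝ}

theorem reverse (hq : IsInterleavedPath q k) : IsInterleavedPath (fun t => q (1 - t)) k :=
  fun s t => by simpa [abs_sub_comm] using hq (1 - s) (1 - t)

theorem exists_injective_infinitePart (hq : IsInterleavedPath q k) (hk : 0 ≤ k) (hkh : k < h) :
    ∃ ψ : (q 0).InfinitePart → (q 1).InfinitePart, Function.Injective ψ ∧
      ∀ e, dist (ψ e).1 e.1 ≤ h := by
  obtain ⟨ψ, hψ, hψd⟩ := (hq.boundedMotion_infiniteMult hk hkh).exists_injective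
    (hk.trans hkh.le) zero_le_one
  exact ⟨fun e => ψ ⟨e, subset_univ _⟩, fun e e' heq => congrArg Subtype.val (hψ heq),
    fun e => by simpa using hψd ⟨e, subset_univ _⟩⟩

theorem exists_injective_properPart_sum (hq : IsInterleavedPath q k) (hk : 0 ≤ k) (hkh : k < h) :
    ∃ φ : (q 0).ProperPart ⊕ ℝ × ℕ → (q 1).ProperPart ⊕ ℝ × ℕ, Function.Injective φ ∧
      ∀ e, dist (withDiagonal Sigma.fst (φ e)) (withDiagonal Sigma.fst e) ≤ h := by
  have hmotion := hq.boundedMotion_properMult hk hkh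
  have hcount : Countable (q 0).ProperPart :=
    countable_sigma_fin (m := fun x : ℝ × ℝ => (q 0).properMult x.1 x.2) <|
      (hmotion.countable_ne_zero 0).mono fun _ hx =>
        And.intro ((q 0).lt_of_properMult_ne_zero hx) hx
  obtain ⟨φ, hφ, hφd⟩ := hmotion.exists_injective (hk.trans hkh.le) zero_le_one
  exact exists_injective_withDiagonal (hk.trans hkh.le) hφ (fun e => by simpa using hφd e)
    fun e he => abs_sub_le_of_not_closedBall_subset ((q 0).lt_of_properPart e) (by simpa using he)

theorem bottleneckDist_le (hq : IsInterleavedPath q k) (hk : 0 ≤ k) :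
    bottleneckDist (q 0).diagram (q 1).diagram ≤ ENNReal.ofReal k := by
  refine ENNReal.le_of_forall_pos_le_add fun ε hε _ => ?_
  have hkh : k < k + ε := lt_add_of_pos_right k hε
  rw [← ENNReal.ofReal_coe_nnreal (p := ε), ← ENNReal.ofReal_add hk ε.coe_nonneg]
  obtain ⟨ψ, hψ, hψd⟩ := hq.exists_injective_infinitePart hk hkh
  obtain ⟨φ, hφ, hφd⟩ := hq.exists_injective_properPart_sum hk hkh
  have hrevψ := hq.reverse.exists_injective_infinitePart hk hkh
  have hrevφ := hq.reverse.exists_injective_properPart_sum hk hkh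
  beta_reduce at hrevψ hrevφ
  rw [sub_zero, sub_self] at hrevψ hrevφ
  obtain ⟨ψ', hψ', hψd'⟩ := hrevψ
  obtain ⟨φ', hφ', hφd'⟩ := hrevφ
  obtain ⟨Ψ, hΨ, hΨd⟩ := Function.Embedding.schroeder_bernstein_of_rel hψ hψ'
    (fun e e' => dist e'.1 e.1 ≤ k + ε) hψd fun e => (dist_comm _ _).trans_le (hψd' e)
  obtain ⟨Φ, hΦ, hΦd⟩ := Function.Embedding.schroeder_bernstein_of_rel hφ hφ'
    (fun e e' => dist (withDiagonal Sigma.fst e') (withDiagonal Sigma.fst e) ≤ k + ε) hφd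
    fun e => (dist_comm _ _).trans_le (hφd' e)
  exact bottleneckDist_diagram_le hΨ hΨd hΦ hΦd

end IsInterleavedPath

end CategoricalPersistenceFunction

/-! ### Weights on a fixed set of edges -/

namespace CategoricalPersistenceFunction

section

variable {E : Type*} {Q : (E → ℝ) → CategoricalPersistenceFunction ℝ}

theorem isInterleavedPath_lineMap
    (hQ : ∀ f g η, 0 < η → (∀ e, |f e - g e| ≤ η) → Interleaved (Q f) (Q g) η)
    {f g : E → ℝ} {k : ℝ} (hk : 0 < k) (hfg : ∀ e, |f e - g e| ≤ k) :
    IsInterleavedPath (fun t => Q (AffineMap.lineMap f g t)) k := by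
  intro s t
  obtain rfl | hst := eq_or_ne s t
  · simpa using Interleaved.refl _
  · refine hQ _ _ _ (mul_pos (abs_pos.2 (sub_ne_zero.2 hst)) hk) fun e => ?_
    rw [AffineMap.pi_lineMap_apply, AffineMap.pi_lineMap_apply, ← Real.dist_eq,
      dist_lineMap_lineMap, Real.dist_eq, Real.dist_eq]
    exact mul_le_mul_of_nonneg_left (hfg e) (abs_nonneg _)

theorem bottleneckDist_le_iSup_abs_sub
    (hQ : ∀ f g η, 0 < η → (∀ e, |f e - g e| ≤ η) → Interleaved (Q f) (Q g) η) (f g : E → ℝ) :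
    bottleneckDist (Q f).diagram (Q g).diagram ≤ ⨆ e, ENNReal.ofReal |f e - g e| := by
  refine le_of_forall_gt_imp_ge_of_dense fun d hd => ?_
  obtain ⟨k, hk, hfgk, hkd⟩ := ENNReal.lt_iff_exists_real_btwn.1 hd
  have hk0 : 0 < k := ENNReal.ofReal_pos.1 (bot_le.trans_lt hfgk)
  have hfg (e : E) : |f e - g e| ≤ k := (ENNReal.ofReal_le_ofReal_iff hk).1
    ((le_iSup (fun e => ENNReal.ofReal |f e - g e|) e).trans hfgk.le)
  have hpath := isInterleavedPath_lineMap hQ hk0 hfg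
  simpa using (hpath.bottleneckDist_le hk).trans hkd.le

end

end CategoricalPersistenceFunction

/-! ### Weighted graphs with the same underlying graph -/

/-- Isomorphic graphs are isomorphic objects of the category of graphs. -/
def FinGraph.isoOfGraphIso {G H : FinGraph.{w}} (ψ : G.graph ≃g H.graph) : G ≅ H where
  hom := ψ.toCopy
  inv := ψ.symm.toCopy
  hom_inv_id := SimpleGraph.Copy.ext fun x => ψ.symm_apply_apply x
  inv_hom_id := SimpleGraph.Copy.ext fun x => ψ.apply_symm_apply x

namespace WeightedGraph

/-- The graph underlying `W` with the weight `f`. -/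
def reweight (W : WeightedGraph.{w}) (f : W.graph.edgeSet → ℝ) : WeightedGraph.{w} :=
  ⟨W.toFinGraph, f⟩

theorem weightDiff_reweight_refl (W : WeightedGraph.{w}) (f g : W.graph.edgeSet → ℝ) :
    weightDiff (W.reweight f) (W.reweight g) SimpleGraph.Iso.refl =
      ⨆ e, ENNReal.ofReal |f e - g e| := by
  refine iSup_congr fun e => ?_
  have hrefl : (SimpleGraph.Iso.refl (G := W.graph)).mapEdgeSet e = e :=
    Subtype.ext (congrFun Sym2.map_id e.1)
  exact congrArg (fun e' => ENNReal.ofReal |f e - g e'|) hrefl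

theorem sublevel_adj_iff {W W' : WeightedGraph.{w}} (ψ : W.graph ≃g W'.graph)
    (hψ : ∀ e, W'.weight (ψ.mapEdgeSet e) = W.weight e) (u : ℝ) {x y : W.V} :
    (W'.sublevel u).Adj (ψ x) (ψ y) ↔ (W.sublevel u).Adj x y := by
  have hweight (h : W.graph.Adj x y) :
      W'.weight ⟨s(ψ x, ψ y), ψ.map_adj_iff.2 h⟩ = W.weight ⟨s(x, y), h⟩ := hψ ⟨s(x, y), h⟩
  exact ⟨fun ⟨h, hu⟩ => ⟨ψ.map_adj_iff.1 h, hweight (ψ.map_adj_iff.1 h) ▸ hu⟩,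
    fun ⟨h, hu⟩ => ⟨ψ.map_adj_iff.2 h, (hweight h).trans_le hu⟩⟩

theorem mem_sublevel_verts_iff {W W' : WeightedGraph.{w}} (ψ : W.graph ≃g W'.graph)
    (hψ : ∀ e, W'.weight (ψ.mapEdgeSet e) = W.weight e) (u : ℝ) {x : W.V} :
    x ∈ (W.sublevel u).verts ↔ ψ x ∈ (W'.sublevel u).verts := by
  change (∃ y, (W.sublevel u).Adj x y) ↔ ∃ y, (W'.sublevel u).Adj (ψ x) y
  rw [ψ.surjective.exists]
  simp only [sublevel_adj_iff ψ hψ]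

/-- The isomorphism of sublevel graphs induced by a weight-preserving isomorphism. -/
def sublevelIso {W W' : WeightedGraph.{w}} (ψ : W.graph ≃g W'.graph)
    (hψ : ∀ e, W'.weight (ψ.mapEdgeSet e) = W.weight e) (u : ℝ) :
    (W.sublevel u).coe ≃g (W'.sublevel u).coe where
  toEquiv := ψ.toEquiv.subtypeEquiv fun _ => mem_sublevel_verts_iff ψ hψ u
  map_rel_iff' := sublevel_adj_iff ψ hψ u

/-- The isomorphism of filtrations induced by a weight-preserving isomorphism. -/
def filtrationIso {W W' : WeightedGraph.{w}} (ψ : W.graph ≃g W'.graph)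
    (hψ : ∀ e, W'.weight (ψ.mapEdgeSet e) = W.weight e) : W.filtration ≅ W'.filtration :=
  NatIso.ofComponents fun u => FinGraph.isoOfGraphIso (sublevelIso ψ hψ u)

end WeightedGraph

namespace IpFunctionGenerator

variable (p : IpFunctionGenerator FinGraph.{w})

theorem ofWeighted_eq_reweight {W W' : WeightedGraph.{w}} (ψ : W.graph ≃g W'.graph) :
    p.ofWeighted W' = p.ofWeighted (W.reweight fun e => W'.weight (ψ.mapEdgeSet e)) :=
  let f := fun e => W'.weight (ψ.mapEdgeSet e)
  (p.iso_invariant _ _ _ _ ⟨WeightedGraph.filtrationIso (W := W.reweight f) ψ fun _ => rfl⟩).symm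

variable {p}

theorem Balanced.interleaved_reweight (hp : p.Balanced) (W : WeightedGraph.{w})
    {f g : W.graph.edgeSet → ℝ} {η : ℝ} (hη : 0 < η) (hfg : ∀ e, |f e - g e| ≤ η) :
    (p.ofWeighted (W.reweight f)).Interleaved (p.ofWeighted (W.reweight g)) η := by
  have hbal {f g : W.graph.edgeSet → ℝ} (hfg : ∀ e, |f e - g e| ≤ η) :=
    hp (W.reweight f) (W.reweight g) SimpleGraph.Iso.refl η hη <|
      (W.weightDiff_reweight_refl f g).trans_le
        (iSup_le fun e => ENNReal.ofReal_le_ofReal (hfg e))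
  exact fun u v huv => ⟨hbal hfg u v huv, hbal (fun e => abs_sub_comm (f e) (g e) ▸ hfg e) u v huv⟩

end IpFunctionGenerator

theorem theorem1 (p : IpFunctionGenerator FinGraph.{w}) (hp : p.Balanced)
    (W W' : WeightedGraph.{w}) :
    bottleneckDist (p.ofWeighted W).diagram (p.ofWeighted W').diagram ≤
      WeightedGraph.naturalPseudodist W W' := by
  refine le_iInf fun ψ => ?_
  rw [p.ofWeighted_eq_reweight ψ]
  exact CategoricalPersistenceFunction.bottleneckDist_le_iSup_abs_sub
    (fun f g η hη hfg => hp.interleaved_reweight W hη hfg) W.weight _
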